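/- Let $n\ge 0$, $t_c>0$, and let $x_1,\dots,x_n$ and $m_1,\dots,m_n$ be real-valued functions, continuous on $[0,t_c)$ and differentiable on $(0,t_c)$, that satisfy there the Degasperis--Procesi peakon equations \[ \dot x_k=\sum_{i=1}^n m_i\,e^{-|x_k-x_i|},\qquad \dot m_k=2m_k\sum_{i=1}^n m_i\,\operatorname{sgn}(x_k-x_i)\,e^{-|x_k-x_i|},\qquad 1\le k\le n, \] with $\operatorname{sgn}(0)=0$, and $x_1(0)<x_2(0)<\cdots<x_n(0)$; the initial masses $m_i(0)\in\mathbb R$ may have any signs. For $i\neq j$ we say that the $i$-th and the $j$-th peakon collide at $t_c$ if $x_i(t)$ and $x_j(t)$ have a common finite limit as $t\to t_c^-$; a multiple collision happens at $t_c$ if more than two of the positions have a common finite limit as $t\to t_c^-$. For $0\le p\le n$ let \[ M_p=\sum_{1\le i_1<\cdots<i_p\le n}\ \prod_{j=1}^{p}m_{i_j}\ \prod_{j=1}^{p-1}\bigl(1-e^{x_{i_j}-x_{i_{j+1}}}\bigr)^2, \] so that $M_n=m_1\cdots m_n\prod_{j=1}^{n-1}(1-e^{x_j-x_{j+1}})^2$.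 Suppose that $M_n\neq0$ at $t=0$. Then: (1) If the $i$-th peakon collides with another peakon at $t_c$, then $m_i$ blows up at $t_c$: $|m_i(t)|\to\infty$ as $t\to t_c^-$. (2) No mass $m_i$ vanishes or changes sign on $[0,t_c)$: for each $i$, either $m_i(t)>0$ for all $t\in[0,t_c)$, or $m_i(t)<0$ for all $t\in[0,t_c)$. (3) There is no multiple collision at $t_c$: peakons collide only in pairs. (4) If the $i$-th and the $j$-th peakon collide at $t_c$, then their distance $|x_i(t)-x_j(t)|$ has a simple zero at $t_c$: for $t<t_c$ close to $t_c$ it coincides with a function that is analytic at $t_c$ and has a zero of order exactly $1$ there. -/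

import Mathlib

open Filter Topology Set

noncomputable section

namespace DPPeakon

/-- The multipeakon profile `u(y) = ∑ i, m i * exp (-|y - x i|)` with positions `x` and
masses `m`. -/
def profile {n : ℕ} (x m : Fin n → ℝ) (y : ℝ) : ℝ :=
  ∑ i, m i * Real.exp (-|y - x i|)

/-- The right-hand side of the equation for the `k`-th mass,
`2 m_k ∑ i, m_i sgn (x_k - x_i) exp (-|x_k - x_i|)`, where `sgn 0 = 0`. -/
def massRate {n : ℕ} (x m : Fin n → ℝ) (k : Fin n) : ℝ :=
  2 * m k * ∑ i, m i * Real.sign (x k - x i) * Real.exp (-|x k - x i|)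

/-- `x t k`, `m t k` (`0 ≤ t < T`) solve the Degasperis-Procesi peakon equations, starting
from positions in strictly increasing order; the masses are arbitrary real numbers. -/
structure IsPeakonSolution {n : ℕ} (x m : ℝ → Fin n → ℝ) (T : ℝ) : Prop where
  strictMono_initial : StrictMono (x 0)
  continuousOn_position : ∀ k, ContinuousOn (fun t => x t k) (Ico 0 T)
  continuousOn_mass : ∀ k, ContinuousOn (fun t => m t k) (Ico 0 T)
  hasDerivAt_position : ∀ t ∈ Ioo 0 T, ∀ k,
    HasDerivAt (fun s => x s k) (profile (x t) (m t) (x t k)) t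
  hasDerivAt_mass : ∀ t ∈ Ioo 0 T, ∀ k,
    HasDerivAt (fun s => m s k) (massRate (x t) (m t) k) t

/-- The constant of motion `M_p`: the sum, over the `p`-element sets of labels
`i_0 < ⋯ < i_{p-1}` (given by their increasing enumerations), of
`(∏ j, m_{i_j}) * ∏_{j < p - 1} (1 - exp (x_{i_j} - x_{i_{j+1}})) ^ 2`. -/
def constantOfMotion {n : ℕ} (p : ℕ) (x m : Fin n → ℝ) : ℝ :=
  letI : Fintype (Fin p ↪o Fin n) := Fintype.ofFinite _
  ∑ I : Fin p ↪o Fin n,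
    (∏ j, m (I j)) *
      ∏ j : Fin (p - 1),
        (1 - Real.exp (x (I ⟨j, by omega⟩) - x (I ⟨j + 1, by omega⟩))) ^ 2

/-- The peakons with the distinct labels `i` and `j` collide at the time `tc`: their positions
have a common limit as `t` increases to `tc`. -/
def CollideAt {n : ℕ} (x : ℝ → Fin n → ℝ) (tc : ℝ) (i j : Fin n) : Prop :=
  i ≠ j ∧ ∃ c : ℝ, Tendsto (fun t => x t i) (𝓝[<] tc) (𝓝 c) ∧
    Tendsto (fun t => x t j) (𝓝[<] tc) (𝓝 c)

/-- More than two peakons have the same limiting position as `t` increases to `tc`. -/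
def MultipleCollisionAt {n : ℕ} (x : ℝ → Fin n → ℝ) (tc : ℝ) : Prop :=
  ∃ i j k : Fin n, i ≠ j ∧ i ≠ k ∧ j ≠ k ∧
    ∃ c : ℝ, Tendsto (fun t => x t i) (𝓝[<] tc) (𝓝 c) ∧
      Tendsto (fun t => x t j) (𝓝[<] tc) (𝓝 c) ∧
      Tendsto (fun t => x t k) (𝓝[<] tc) (𝓝 c)

/-- The function `m` blows up as `t` increases to `tc`. -/
def BlowsUpAt (m : ℝ → ℝ) (tc : ℝ) : Prop :=
  Tendsto (fun t => |m t|) (𝓝[<] tc) atTop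

/-- The function `d`, given for times before `tc`, coincides just before `tc` with a function
that is analytic at `tc` and has a zero of order exactly one there. -/
def HasSimpleZeroAt (d : ℝ → ℝ) (tc : ℝ) : Prop :=
  ∃ f : ℝ → ℝ, AnalyticAt ℝ f tc ∧ (∀ᶠ t in 𝓝[<] tc, d t = f t) ∧ analyticOrderAt f tc = 1

end DPPeakon

end

/-!
Why the theorem holds. The peakon equations are the compatibility condition of a Lax pair. In the
gap between two neighbouring peakons the wave function is `a exp y + b + c exp (-y)` with `a`, `b`,
`c` polynomial in the spectral parameter, and crossing a peakon adds to `(a, b, c)` its image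
under a nilpotent matrix of rank one (`wave`). Its time evolution in each gap is explicit
(`hasDerivAt_wave`).

*Conservation.* Behind the last peakon `a` is constant in time. Its leading coefficient is
`± M_n` (`wave_leading_eq_constantOfMotion`), so `M_n` is conserved, and since `M_n ≠ 0`, positions
cannot cross and masses cannot vanish (`IsPeakonSolution.strictMono`,
`IsPeakonSolution.mass_ne_zero`).

*Meromorphy.* Behind the last peakon the coefficients of `b` solve a linear equation with constant
coefficients, and the coefficients of `c` are primitives of quadratic expressions in those of `b`.
Hence all of them extend analytically to the whole line (`exists_analyticAt_eqOn_wave`). The wave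
function behind a peakon determines the position and mass of that peakon rationally, so peeling
off the peakons from the right shows that all masses and all `exp (x k)` are meromorphic at the
collision time (`meromorphicLeft_wave`). The last position is bounded above; applying this to the
reflected solution bounds the first position below, so that all positions have finite limits and
extend analytically (`exists_analyticAt_X`).

*Orders.* Comparing leading terms in the differential equations shows that each mass has at most a
simple pole, and none if no neighbour shares its limiting position (`order_mass_ge`). Conservation
of `M_n` says that the orders of all masses plus twice the orders of all gaps sum to zero.
Distributing the order of each gap to its two ends writes this as a vanishing sum of nonnegative
integers, one for each peakon. So each of them vanishes: a peakon that shares its limiting position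
with a neighbour has a mass with a simple pole and exactly one vanishing adjacent gap, whose zero
is simple (`orders_of_collision`).
-/

namespace DPPeakon

/-! ### The peakon flow in exponential coordinates -/

/-- The partial sum `∑ i < k, m i * X i`: between the peakons `k - 1` and `k` the profile is
`leftMoment X m k * exp (-y) + rightMoment n X m k * exp y`, where `X i = exp (x i)`. -/
noncomputable def leftMoment (X m : ℕ → ℝ) (k : ℕ) : ℝ := ∑ i ∈ Finset.range k, m i * X i

/-- The partial sum `∑ i ≥ k, m i / X i` over the labels `i < n`. -/
noncomputable def rightMoment (n : ℕ) (X m : ℕ → ℝ) (k : ℕ) : ℝ := ∑ i ∈ Finset.Ico k n, m i / X i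

/-- The peakon equations on `(0, T)` for ordered positions, written in the variables
`X k = exp (x k)`. Labels are the natural numbers below `n`; values at other labels are
irrelevant. -/
structure OrderedFlow (n : ℕ) (X m : ℝ → ℕ → ℝ) (T : ℝ) : Prop where
  pos : ∀ t ∈ Ioo 0 T, ∀ k < n, 0 < X t k
  lt_succ : ∀ t ∈ Ioo 0 T, ∀ k, k + 1 < n → X t k < X t (k + 1)
  hasDerivAt_X : ∀ t ∈ Ioo 0 T, ∀ k < n, HasDerivAt (fun s => X s k)
    (X t k * (leftMoment (X t) (m t) k / X t k + m t k
      + rightMoment n (X t) (m t) (k + 1) * X t k)) t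
  hasDerivAt_m : ∀ t ∈ Ioo 0 T, ∀ k < n, HasDerivAt (fun s => m s k)
    (2 * m t k * (leftMoment (X t) (m t) k / X t k
      - rightMoment n (X t) (m t) (k + 1) * X t k)) t

/-! ### The wave function of the Lax pair -/

/-- Coefficients of the wave function of the Lax pair. Between the peakons `k - 1` and `k` it is
`a z * exp y + b z + c z * exp (-y)` with polynomials `a`, `b`, `c` in the spectral parameter
`z`, normalised to `exp y` to the left of all peakons; `wave X m k i` is the triple of the
coefficients of `z ^ i`. Crossing the peakon `k` adds to `(a, b, c)` the multiple
`z * m k * ψ` of the vector `(-1 / X k, 2, -X k)`, where `ψ` is the value at the peakon. -/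
noncomputable def wave (X m : ℕ → ℝ) : ℕ → ℕ → ℝ × ℝ × ℝ
  | 0, 0 => (1, 0, 0)
  | 0, _ + 1 => (0, 0, 0)
  | k + 1, 0 => wave X m k 0
  | k + 1, i + 1 =>
    ((wave X m k (i + 1)).1 - m k / X k *
        (X k * (wave X m k i).1 + (wave X m k i).2.1 + (wave X m k i).2.2 / X k),
      (wave X m k (i + 1)).2.1 + 2 * m k *
        (X k * (wave X m k i).1 + (wave X m k i).2.1 + (wave X m k i).2.2 / X k),
      (wave X m k (i + 1)).2.2 - m k * X k *
        (X k * (wave X m k i).1 + (wave X m k i).2.1 + (wave X m k i).2.2 / X k))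

/-- The coefficient of `z ^ i` in the value of the wave function at the peakon `k`, computed from
its coefficients to the left of that peakon. -/
noncomputable def waveAt (X m : ℕ → ℝ) (k i : ℕ) : ℝ :=
  X k * (wave X m k i).1 + (wave X m k i).2.1 + (wave X m k i).2.2 / X k

theorem wave_succ_succ (X m : ℕ → ℝ) (k i : ℕ) : wave X m (k + 1) (i + 1) =
    ((wave X m k (i + 1)).1 - m k / X k * waveAt X m k i,
      (wave X m k (i + 1)).2.1 + 2 * m k * waveAt X m k i,
      (wave X m k (i + 1)).2.2 - m k * X k * waveAt X m k i) := rfl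

theorem wave_succ_zero (X m : ℕ → ℝ) (k : ℕ) : wave X m (k + 1) 0 = wave X m k 0 := rfl

theorem wave_zero_right (X m : ℕ → ℝ) (k : ℕ) : wave X m k 0 = (1, 0, 0) := by
  induction k with
  | zero => rfl
  | succ k ih => rw [wave_succ_zero, ih]

theorem wave_of_lt (X m : ℕ → ℝ) {k i : ℕ} (h : k < i) : wave X m k i = (0, 0, 0) := by
  induction k generalizing i with
  | zero =>
    obtain ⟨i, rfl⟩ := Nat.exists_eq_succ_of_ne_zero h.ne'
    rfl
  | succ k ih =>
    obtain ⟨i, rfl⟩ := Nat.exists_eq_succ_of_ne_zero (Nat.ne_zero_of_lt h)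
    rw [Nat.succ_eq_add_one, wave_succ_succ, waveAt, ih (i := i) (by omega),
      ih (i := i + 1) (by omega)]
    simp

theorem wave_one_snd (X m : ℕ → ℝ) (k : ℕ) : (wave X m k 1).2.1 = 2 * leftMoment X m k := by
  induction k with
  | zero => simp [wave, leftMoment]
  | succ k ih =>
    rw [wave_succ_succ, waveAt, wave_zero_right, ih]
    simp [leftMoment, Finset.sum_range_succ]
    ring

/-- The wave function is continuous across a peakon, so its value there can be computed from
either side. -/
theorem waveAt_eq_succ (X m : ℕ → ℝ) (k i : ℕ) (hX : X k ≠ 0) :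
    waveAt X m k i = X k * (wave X m (k + 1) i).1 + (wave X m (k + 1) i).2.1
      + (wave X m (k + 1) i).2.2 / X k := by
  cases i with
  | zero => rw [wave_succ_zero]; rfl
  | succ i =>
    rw [wave_succ_succ]
    simp only [waveAt]
    field_simp
    ring

/-- The leading coefficients behind the peakon `k` are proportional to the jump direction
there. -/
theorem wave_succ_leading (X m : ℕ → ℝ) (k : ℕ) (hX : X k ≠ 0) :
    (wave X m (k + 1) (k + 1)).2.1 = -2 * X k * (wave X m (k + 1) (k + 1)).1 ∧
    (wave X m (k + 1) (k + 1)).2.2 = X k ^ 2 * (wave X m (k + 1) (k + 1)).1 := by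
  rw [wave_succ_succ, wave_of_lt X m (Nat.lt_succ_self k)]
  constructor <;> field_simp <;> ring

theorem wave_succ_leading_fst (X m : ℕ → ℝ) (k : ℕ) :
    (wave X m (k + 1) (k + 1)).1 = -(m k / X k * waveAt X m k k) := by
  rw [wave_succ_succ, wave_of_lt X m (Nat.lt_succ_self k)]
  simp

/-- The leading coefficient of the wave function behind the peakon `k` is, up to sign, the
constant of motion of highest degree of the peakons `0, …, k`. -/
theorem wave_leading_eq_prod (X m : ℕ → ℝ) (k : ℕ) (hX : ∀ j ≤ k, X j ≠ 0) :
    (wave X m (k + 1) (k + 1)).1 = (-1) ^ (k + 1) * (∏ i ∈ Finset.range (k + 1), m i) *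
      ∏ j ∈ Finset.range k, (1 - X j / X (j + 1)) ^ 2 := by
  induction k with
  | zero =>
    have := hX 0 le_rfl
    rw [wave_succ_leading_fst]
    simp [waveAt, wave]
    field_simp
  | succ k ih =>
    have h1 := hX k (by omega)
    have h2 := hX (k + 1) le_rfl
    rw [wave_succ_leading_fst, waveAt, (wave_succ_leading X m k h1).1,
      (wave_succ_leading X m k h1).2, ih fun j hj => hX j (by omega),
      Finset.prod_range_succ m (k + 1),
      Finset.prod_range_succ (fun j => (1 - X j / X (j + 1)) ^ 2) k]
    field_simp
    ring

/-! ### Evolution of the wave function -/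

theorem leftMoment_succ (X m : ℕ → ℝ) (k : ℕ) :
    leftMoment X m (k + 1) = leftMoment X m k + m k * X k :=
  Finset.sum_range_succ _ _

theorem rightMoment_eq_add (n : ℕ) (X m : ℕ → ℝ) {k : ℕ} (hk : k < n) :
    rightMoment n X m k = m k / X k + rightMoment n X m (k + 1) :=
  Finset.sum_eq_sum_Ico_succ_bot hk _

theorem rightMoment_self (n : ℕ) (X m : ℕ → ℝ) : rightMoment n X m n = 0 := by
  simp [rightMoment]

/-- The time evolution of the wave function in the gap to the left of the peakon `k`. -/
theorem OrderedFlow.hasDerivAt_wave {n : ℕ} {X m : ℝ → ℕ → ℝ} {T : ℝ} (h : OrderedFlow n X m T)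
    {t : ℝ} (ht : t ∈ Ioo 0 T) {k : ℕ} (hk : k ≤ n) (i : ℕ) :
    HasDerivAt (fun s => (wave (X s) (m s) k i).1)
      (rightMoment n (X t) (m t) k * (wave (X t) (m t) k i).2.1) t ∧
    HasDerivAt (fun s => (wave (X s) (m s) k i).2.1)
      ((wave (X t) (m t) k (i + 1)).2.1
        - 2 * leftMoment (X t) (m t) k * (wave (X t) (m t) k i).1
        + 2 * rightMoment n (X t) (m t) k * (wave (X t) (m t) k i).2.2) t ∧
    HasDerivAt (fun s => (wave (X s) (m s) k i).2.2)
      (-leftMoment (X t) (m t) k * (wave (X t) (m t) k i).2.1) t := by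
  induction k generalizing i with
  | zero =>
    cases i <;> simp [wave, leftMoment, hasDerivAt_const]
  | succ k ih =>
    cases i with
    | zero =>
      simp only [wave_zero_right, zero_add, wave_one_snd]
      exact ⟨(hasDerivAt_const t 1).congr_deriv (by ring),
        (hasDerivAt_const t 0).congr_deriv (by ring),
        (hasDerivAt_const t 0).congr_deriv (by ring)⟩
    | succ i =>
      have hX0 : X t k ≠ 0 := (h.pos t ht k hk).ne'
      have hX := h.hasDerivAt_X t ht k hk
      have hm := h.hasDerivAt_m t ht k hk
      obtain ⟨a0, b0, c0⟩ := ih (by omega) i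
      obtain ⟨a1, b1, c1⟩ := ih (by omega) (i + 1)
      have hw : HasDerivAt (fun s => waveAt (X s) (m s) k i) _ t :=
        ((hX.mul a0).add b0).add (c0.div hX hX0)
      simp only [wave_succ_succ]
      have e1 := rightMoment_eq_add n (X t) (m t) hk
      have e2 := leftMoment_succ (X t) (m t) k
      simp only [e1] at a0 b0 c0 a1 b1 c1 hw
      rw [e2]
      refine ⟨(a1.sub ((hm.div hX hX0).mul hw)).congr_deriv ?_,
        (b1.add ((hm.const_mul 2).mul hw)).congr_deriv ?_,
        (c1.sub ((hm.mul hX).mul hw)).congr_deriv ?_⟩ <;>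
      · simp only [waveAt, Pi.mul_apply, Pi.div_apply]
        generalize rightMoment n (X t) (m t) (k + 1) = q
        generalize leftMoment (X t) (m t) k = p
        generalize wave (X t) (m t) k i = v0
        generalize wave (X t) (m t) k (i + 1) = v1
        generalize wave (X t) (m t) k (i + 1 + 1) = v2
        field_simp
        ring

/-! ### Analyticity behind the last peakon -/

/-- A solution on an interval of a linear differential equation with constant coefficients
extends to an analytic function on the whole line. -/
theorem exists_analyticAt_eqOn_of_linear_ode {E : Type*} [NormedAddCommGroup E] [NormedSpace ℝ E]
    [CompleteSpace E] (N : E →L[ℝ] E) {y : ℝ → E} {a b : ℝ}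
    (hy : ∀ t ∈ Ioo a b, HasDerivAt y (N (y t)) t) :
    ∃ Y : ℝ → E, (∀ t, AnalyticAt ℝ Y t) ∧ EqOn y Y (Ioo a b) := by
  rcases (Ioo a b).eq_empty_or_nonempty with h | ⟨t₀, ht₀⟩
  · exact ⟨fun _ => 0, fun _ => analyticAt_const, by simp [h]⟩
  -- `exp (-t N) y t` is constant.
  have hexp : ∀ (M : E →L[ℝ] E) (t : ℝ),
      HasDerivAt (fun u : ℝ => NormedSpace.exp (u • M)) (NormedSpace.exp (t • M) * M) t :=
    fun M t => hasDerivAt_exp_smul_const M t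
  have hconst : ∀ t ∈ Ioo a b, NormedSpace.exp (t • (-N)) (y t)
      = NormedSpace.exp (t₀ • (-N)) (y t₀) := by
    intro t ht
    refine IsOpen.is_const_of_deriv_eq_zero (f := fun t => NormedSpace.exp (t • (-N)) (y t))
      isOpen_Ioo isPreconnected_Ioo (fun s hs => ?_) (fun s hs => ?_) ht ht₀
    · exact ((hexp (-N) s).clm_apply (hy s hs)).differentiableAt.differentiableWithinAt
    · rw [((hexp (-N) s).clm_apply (hy s hs)).deriv]
      simp
  refine ⟨fun t => NormedSpace.exp (t • N) (NormedSpace.exp (t₀ • (-N)) (y t₀)), fun t => ?_,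
    fun t ht => ?_⟩
  · have h1 : AnalyticAt ℝ (fun u : ℝ => NormedSpace.exp (u • N)) t :=
      (NormedSpace.exp_analytic (𝕂 := ℝ) (t • N)).comp (f := fun u : ℝ => u • N)
        (analyticAt_id.smul analyticAt_const)
    exact (ContinuousLinearMap.apply ℝ E _).analyticAt _ |>.comp h1
  · let _ : NormedAlgebra ℚ (E →L[ℝ] E) := NormedAlgebra.restrictScalars ℚ ℝ _
    change y t = NormedSpace.exp (t • N) (NormedSpace.exp (t₀ • (-N)) (y t₀))
    rw [← hconst t ht]
    change y t = (NormedSpace.exp (t • N) * NormedSpace.exp (t • (-N))) (y t)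
    rw [← NormedSpace.exp_add_of_commute
      (((Commute.refl N).neg_right.smul_left t).smul_right t)]
    simp

/-- Behind the last peakon the first coefficients of the wave function are constants of motion. -/
theorem OrderedFlow.exists_wave_fst_eq {n : ℕ} {X m : ℝ → ℕ → ℝ} {T : ℝ}
    (h : OrderedFlow n X m T) (i : ℕ) :
    ∃ a : ℝ, ∀ t ∈ Ioo 0 T, (wave (X t) (m t) n i).1 = a := by
  have hd : ∀ t ∈ Ioo 0 T, HasDerivAt (fun s => (wave (X s) (m s) n i).1) 0 t := fun t ht =>
    (h.hasDerivAt_wave ht le_rfl i).1.congr_deriv (by rw [rightMoment_self, zero_mul])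
  exact IsOpen.exists_is_const_of_deriv_eq_zero isOpen_Ioo isPreconnected_Ioo
    (fun t ht => (hd t ht).differentiableAt.differentiableWithinAt) fun t ht => (hd t ht).deriv

/-- The space of the coefficients of `z ^ i`, `i ≤ n + 1`, of a polynomial. The index `n + 1`,
above the degree of the wave function, keeps the index `1` distinct from `0` also when `n = 0`. -/
abbrev CoeffSpace (n : ℕ) : Type := Fin (n + 2) → ℝ

/-- Behind the last peakon every coefficient of the wave function extends to an analytic function
of time on the whole line. -/
theorem OrderedFlow.exists_analyticAt_eqOn_wave {n : ℕ} {X m : ℝ → ℕ → ℝ} {T : ℝ}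
    (h : OrderedFlow n X m T) (i : ℕ) :
    (∃ f : ℝ → ℝ, (∀ t, AnalyticAt ℝ f t) ∧
      EqOn (fun t => (wave (X t) (m t) n i).1) f (Ioo 0 T)) ∧
    (∃ f : ℝ → ℝ, (∀ t, AnalyticAt ℝ f t) ∧
      EqOn (fun t => (wave (X t) (m t) n i).2.1) f (Ioo 0 T)) ∧
    (∃ f : ℝ → ℝ, (∀ t, AnalyticAt ℝ f t) ∧
      EqOn (fun t => (wave (X t) (m t) n i).2.2) f (Ioo 0 T)) := by
  choose a ha using fun j => h.exists_wave_fst_eq (n := n) (X := X) (m := m) j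
  refine ⟨⟨fun _ => a i, fun _ => analyticAt_const, fun t ht => ha i t ht⟩, ?_⟩
  rcases Nat.lt_or_ge n i with hi | hi
  · have h0 : ∀ t, wave (X t) (m t) n i = (0, 0, 0) := fun t => wave_of_lt _ _ hi
    exact ⟨⟨fun _ => 0, fun _ => analyticAt_const, fun t _ => by simp [h0]⟩,
      ⟨fun _ => 0, fun _ => analyticAt_const, fun t _ => by simp [h0]⟩⟩
  -- The coefficients `b j`, their products `b j * b l` and the coefficients `c j` together solve
  -- a linear equation with constant coefficients.
  let N : CoeffSpace n →ₗ[ℝ] CoeffSpace n :=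
    { toFun := fun v j => (if hj : (j : ℕ) + 1 < n + 2 then v ⟨j + 1, hj⟩ else 0) - a j * v 1
      map_add' := fun v w => by
        ext j; simp only [Pi.add_apply]; split_ifs <;> ring
      map_smul' := fun r v => by
        ext j; simp only [Pi.smul_apply, smul_eq_mul, RingHom.id_apply]; split_ifs <;> ring }
  let L : (CoeffSpace n × (Fin (n + 2) → CoeffSpace n) × CoeffSpace n) →ₗ[ℝ]
      (CoeffSpace n × (Fin (n + 2) → CoeffSpace n) × CoeffSpace n) :=
    { toFun := fun p => (N p.1, fun j => fun l => N (fun j' => p.2.1 j' l) j + N (p.2.1 j) l,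
        fun j => -(1 / 2) * p.2.1 1 j)
      map_add' := fun p q => by
        have e : ∀ l, N (fun j' => (p + q).2.1 j' l)
            = N (fun j' => p.2.1 j' l) + N (fun j' => q.2.1 j' l) := fun l => N.map_add _ _
        ext j l
        · simp
        · simp only [e]
          simp only [map_add, Prod.snd_add, Prod.fst_add, Pi.add_apply]
          ring
        · simp only [Prod.snd_add, Prod.fst_add, Pi.add_apply]
          ring
      map_smul' := fun r q => by
        have e : ∀ l, N (fun j' => (r • q).2.1 j' l) = r • N (fun j' => q.2.1 j' l) :=
          fun l => N.map_smul _ _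
        ext j l
        · simp
        · simp only [e]
          simp only [map_smul, Prod.smul_snd, Prod.smul_fst, Pi.smul_apply, smul_eq_mul,
            RingHom.id_apply]
          ring
        · simp only [Prod.smul_snd, Prod.smul_fst, Pi.smul_apply, smul_eq_mul,
            RingHom.id_apply]
          ring }
  let y : ℝ → CoeffSpace n × (Fin (n + 2) → CoeffSpace n) × CoeffSpace n := fun t =>
    (fun j => (wave (X t) (m t) n j).2.1,
      fun j l => (wave (X t) (m t) n j).2.1 * (wave (X t) (m t) n l).2.1,
      fun j => (wave (X t) (m t) n j).2.2)
  have hN : ∀ t ∈ Ioo 0 T, ∀ j : Fin (n + 2),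
      HasDerivAt (fun s => (wave (X s) (m s) n j).2.1)
        (N (fun j : Fin (n + 2) => (wave (X t) (m t) n j).2.1) j) t := by
    intro t ht j
    refine (h.hasDerivAt_wave ht le_rfl j).2.1.congr_deriv ?_
    have h1 : (wave (X t) (m t) n ((1 : Fin (n + 2)) : ℕ)).2.1
        = 2 * leftMoment (X t) (m t) n := by
      rw [Fin.val_one, wave_one_snd]
    simp only [N, LinearMap.coe_mk, AddHom.coe_mk, rightMoment_self, h1, ha j t ht]
    split_ifs with hj
    · ring
    · rw [wave_of_lt (X t) (m t) (show n < (j : ℕ) + 1 by omega)]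
      ring
  have hy : ∀ t ∈ Ioo 0 T, HasDerivAt y (LinearMap.toContinuousLinearMap L (y t)) t := by
    intro t ht
    refine (hasDerivAt_pi.2 fun j => hN t ht j).prodMk ((hasDerivAt_pi.2 fun j =>
      hasDerivAt_pi.2 fun l => ?_).prodMk (hasDerivAt_pi.2 fun j => ?_))
    · have e : N (fun j' => (y t).2.1 j' l)
          = (wave (X t) (m t) n l).2.1 • N (fun j => (wave (X t) (m t) n j).2.1) := by
        rw [← N.map_smul]
        congr 1
        ext j'
        simp [y, mul_comm]
      have e' : N ((y t).2.1 j)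
          = (wave (X t) (m t) n j).2.1 • N (fun j => (wave (X t) (m t) n j).2.1) := by
        rw [← N.map_smul]
        rfl
      refine ((hN t ht j).mul (hN t ht l)).congr_deriv ?_
      rw [e, e', Pi.smul_apply, Pi.smul_apply, smul_eq_mul, smul_eq_mul]
      ring
    · refine (h.hasDerivAt_wave ht le_rfl j).2.2.congr_deriv ?_
      have h1 : (wave (X t) (m t) n ((1 : Fin (n + 2)) : ℕ)).2.1
          = 2 * leftMoment (X t) (m t) n := by
        rw [Fin.val_one, wave_one_snd]
      change _ = -(1 / 2) * ((wave (X t) (m t) n ((1 : Fin (n + 2)) : ℕ)).2.1 *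
        (wave (X t) (m t) n j).2.1)
      rw [h1]
      ring
  obtain ⟨Y, hY, hyY⟩ := exists_analyticAt_eqOn_of_linear_ode _ hy
  let j : Fin (n + 2) := ⟨i, by omega⟩
  refine ⟨⟨fun t => (Y t).1 j, fun t => ?_, fun t ht => ?_⟩,
    ⟨fun t => (Y t).2.2 j, fun t => ?_, fun t ht => ?_⟩⟩
  · exact analyticAt_pi_iff.1 (analyticAt_fst.comp (hY t)) j
  · change _ = (Y t).1 j
    rw [← hyY ht]
  · exact analyticAt_pi_iff.1 (analyticAt_snd.comp (analyticAt_snd.comp (hY t))) j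
  · change _ = (Y t).2.2 j
    rw [← hyY ht]

/-! ### Meromorphic left germs -/

/-- `f` coincides to the left of `c` with a function that is meromorphic at `c`. -/
def MeromorphicLeft (f : ℝ → ℝ) (c : ℝ) : Prop :=
  ∃ g : ℝ → ℝ, MeromorphicAt g c ∧ f =ᶠ[𝓝[<] c] g

namespace MeromorphicLeft

variable {f g : ℝ → ℝ} {c : ℝ}

theorem congr (hf : MeromorphicLeft f c) (h : g =ᶠ[𝓝[<] c] f) : MeromorphicLeft g c := by
  obtain ⟨F, hF, e⟩ := hf
  exact ⟨F, hF, h.trans e⟩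

theorem const (a : ℝ) : MeromorphicLeft (fun _ => a) c :=
  ⟨fun _ => a, MeromorphicAt.const a c, EventuallyEq.rfl⟩

theorem add (hf : MeromorphicLeft f c) (hg : MeromorphicLeft g c) :
    MeromorphicLeft (fun t => f t + g t) c := by
  obtain ⟨F, hF, eF⟩ := hf
  obtain ⟨G, hG, eG⟩ := hg
  exact ⟨fun t => F t + G t, hF.add hG, eF.add eG⟩

theorem mul (hf : MeromorphicLeft f c) (hg : MeromorphicLeft g c) :
    MeromorphicLeft (fun t => f t * g t) c := by
  obtain ⟨F, hF, eF⟩ := hf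
  obtain ⟨G, hG, eG⟩ := hg
  exact ⟨fun t => F t * G t, hF.mul hG, eF.mul eG⟩

theorem div (hf : MeromorphicLeft f c) (hg : MeromorphicLeft g c) :
    MeromorphicLeft (fun t => f t / g t) c := by
  obtain ⟨F, hF, eF⟩ := hf
  obtain ⟨G, hG, eG⟩ := hg
  exact ⟨fun t => F t / G t, hF.div hG, eF.div eG⟩

theorem neg (hf : MeromorphicLeft f c) : MeromorphicLeft (fun t => -f t) c := by
  obtain ⟨F, hF, eF⟩ := hf
  exact ⟨fun t => -F t, hF.neg, eF.neg⟩

theorem sub (hf : MeromorphicLeft f c) (hg : MeromorphicLeft g c) :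
    MeromorphicLeft (fun t => f t - g t) c := by
  simpa only [sub_eq_add_neg] using hf.add hg.neg

/-- A meromorphic left germ without zeros is an integral power of `t - c` times an analytic
function that does not vanish at `c`. -/
theorem exists_eq_zpow_mul (hf : MeromorphicLeft f c) (h0 : ∀ᶠ t in 𝓝[<] c, f t ≠ 0) :
    ∃ (r : ℤ) (h : ℝ → ℝ), AnalyticAt ℝ h c ∧ h c ≠ 0 ∧
      f =ᶠ[𝓝[<] c] fun t => (t - c) ^ r * h t := by
  obtain ⟨g, hg, e⟩ := hf
  have hle : 𝓝[<] c ≤ 𝓝[≠] c := nhdsWithin_mono _ fun t ht => ne_of_lt ht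
  have htop : meromorphicOrderAt g c ≠ ⊤ := by
    intro htop
    have h1 := (meromorphicOrderAt_eq_top_iff.1 htop).filter_mono hle
    obtain ⟨t, h2, h3, h4⟩ := (h1.and (h0.and e)).exists
    exact h3 (h4.trans h2)
  obtain ⟨r, hr⟩ := WithTop.ne_top_iff_exists.1 htop
  obtain ⟨h, hh, hne, heq⟩ := (meromorphicOrderAt_eq_int_iff hg).1 hr.symm
  refine ⟨r, h, hh, hne, e.trans ?_⟩
  filter_upwards [heq.filter_mono hle] with t ht
  rw [ht, smul_eq_mul]

/-- A meromorphic left germ whose values stay in a compact subset of `(0, ∞)` is analytic and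
positive. -/
theorem exists_analyticAt_of_bounded (hf : MeromorphicLeft f c) {a b : ℝ} (ha : 0 < a)
    (h : ∀ᶠ t in 𝓝[<] c, a ≤ f t ∧ f t ≤ b) :
    ∃ F : ℝ → ℝ, AnalyticAt ℝ F c ∧ 0 < F c ∧ f =ᶠ[𝓝[<] c] F := by
  obtain ⟨g, hg, e⟩ := hf
  have hle : 𝓝[<] c ≤ 𝓝[≠] c := nhdsWithin_mono _ fun t ht => ne_of_lt ht
  have hg' : ∀ᶠ t in 𝓝[<] c, a ≤ g t ∧ g t ≤ b := by
    filter_upwards [h, e] with t h1 h2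
    rwa [← h2]
  have hord : meromorphicOrderAt g c = 0 := by
    rcases lt_trichotomy (meromorphicOrderAt g c) 0 with hlt | heq | hgt
    · have h1 := ((tendsto_norm_atTop_iff_cobounded.2
        (tendsto_cobounded_of_meromorphicOrderAt_neg hlt)).mono_left hle).eventually_gt_atTop b
      obtain ⟨t, h2, h3, h4⟩ := (h1.and hg').exists
      rw [Real.norm_of_nonneg (ha.le.trans h3)] at h2
      exact absurd h4 (not_le.2 h2)
    · exact heq
    · have h1 := (tendsto_zero_of_meromorphicOrderAt_pos hgt).mono_left hle
      obtain ⟨t, h2, h3, _⟩ := ((h1.eventually (gt_mem_nhds ha)).and hg').exists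
      exact absurd h3 (not_le.2 h2)
  obtain ⟨F, hF, hne, heq⟩ := (meromorphicOrderAt_eq_int_iff (n := 0) hg).1 hord
  have e' : f =ᶠ[𝓝[<] c] F := by
    filter_upwards [e, heq.filter_mono hle] with t h1 h2
    rw [h1, h2, zpow_zero, one_smul]
  refine ⟨F, hF, ha.trans_le ?_, e'⟩
  refine ge_of_tendsto
    (hF.continuousAt.tendsto.mono_left (nhdsWithin_le_nhds (s := Iio c))) ?_
  filter_upwards [h, e'] with t h1 h2
  exact h2 ▸ h1.1

end MeromorphicLeft

/-! ### Meromorphy of positions and masses -/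

/-- The leading coefficient of the wave function behind a peakon does not vanish. -/
theorem OrderedFlow.wave_leading_ne_zero {n : ℕ} {X m : ℝ → ℕ → ℝ} {T : ℝ}
    (h : OrderedFlow n X m T) {t : ℝ} (ht : t ∈ Ioo 0 T) (hm : ∀ k < n, m t k ≠ 0)
    {k : ℕ} (hk : k < n) : (wave (X t) (m t) (k + 1) (k + 1)).1 ≠ 0 := by
  rw [wave_leading_eq_prod _ _ _ fun j hj => (h.pos t ht j (by omega)).ne']
  refine mul_ne_zero (mul_ne_zero (pow_ne_zero _ (by norm_num)) ?_) ?_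
  · exact Finset.prod_ne_zero_iff.2 fun j hj => hm j (by have := Finset.mem_range.1 hj; omega)
  · refine Finset.prod_ne_zero_iff.2 fun j hj => pow_ne_zero _ ?_
    have hj' := Finset.mem_range.1 hj
    have h1 := h.lt_succ t ht j (by omega)
    have h2 := h.pos t ht (j + 1) (by omega)
    exact (sub_pos.2 ((div_lt_one h2).2 h1)).ne'

/-- Position and mass of a peakon, expressed by the wave function behind it. -/
theorem OrderedFlow.eq_wave_succ {n : ℕ} {X m : ℝ → ℕ → ℝ} {T : ℝ}
    (h : OrderedFlow n X m T) {t : ℝ} (ht : t ∈ Ioo 0 T) (hm : ∀ k < n, m t k ≠ 0)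
    {k : ℕ} (hk : k < n) :
    X t k = -(wave (X t) (m t) (k + 1) (k + 1)).2.1 /
      (2 * (wave (X t) (m t) (k + 1) (k + 1)).1) ∧
    m t k = -(X t k * (wave (X t) (m t) (k + 1) (k + 1)).1) / waveAt (X t) (m t) k k := by
  have hA := h.wave_leading_ne_zero ht hm hk
  have hX := (h.pos t ht k hk).ne'
  constructor
  · rw [(wave_succ_leading _ _ k hX).1]
    field_simp
  · rw [wave_succ_leading_fst] at hA ⊢
    have hw : waveAt (X t) (m t) k k ≠ 0 := fun h0 => hA (by rw [h0]; ring)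
    field_simp

theorem eventually_mem_Ioo {T : ℝ} (hT : 0 < T) : ∀ᶠ t in 𝓝[<] T, t ∈ Ioo 0 T :=
  Ioo_mem_nhdsLT hT

/-- The peakons are peeled off from the right: the wave function behind a peakon determines the
position and the mass of the peakon rationally, and thereby the wave function before it. -/
theorem OrderedFlow.meromorphicLeft_wave {n : ℕ} {X m : ℝ → ℕ → ℝ} {T : ℝ} (hT : 0 < T)
    (h : OrderedFlow n X m T) (hm : ∀ t ∈ Ioo 0 T, ∀ k < n, m t k ≠ 0) {k : ℕ} (hk : k ≤ n) :
    (∀ i, MeromorphicLeft (fun t => (wave (X t) (m t) k i).1) T ∧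
      MeromorphicLeft (fun t => (wave (X t) (m t) k i).2.1) T ∧
      MeromorphicLeft (fun t => (wave (X t) (m t) k i).2.2) T) ∧
    (k < n → MeromorphicLeft (fun t => X t k) T ∧ MeromorphicLeft (fun t => m t k) T) := by
  induction hk using Nat.decreasingInduction with
  | self =>
    refine ⟨fun i => ?_, fun hn => absurd hn (lt_irrefl n)⟩
    obtain ⟨⟨a, ha, ea⟩, ⟨b, hb, eb⟩, ⟨c, hc, ec⟩⟩ := h.exists_analyticAt_eqOn_wave i
    exact ⟨⟨a, (ha T).meromorphicAt, (eventually_mem_Ioo hT).mono ea⟩,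
      ⟨b, (hb T).meromorphicAt, (eventually_mem_Ioo hT).mono eb⟩,
      ⟨c, (hc T).meromorphicAt, (eventually_mem_Ioo hT).mono ec⟩⟩
  | of_succ k hk ih =>
    have hk : k < n := hk
    obtain ⟨hW, -⟩ := ih
    have hX : MeromorphicLeft (fun t => X t k) T := by
      refine MeromorphicLeft.congr
        ((hW (k + 1)).2.1.neg.div ((MeromorphicLeft.const 2).mul (hW (k + 1)).1)) ?_
      filter_upwards [eventually_mem_Ioo hT] with t ht
      exact (h.eq_wave_succ ht (hm t ht) hk).1
    have hw : ∀ i, MeromorphicLeft (fun t => waveAt (X t) (m t) k i) T := by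
      intro i
      refine MeromorphicLeft.congr (((hX.mul (hW i).1).add (hW i).2.1).add ((hW i).2.2.div hX)) ?_
      filter_upwards [eventually_mem_Ioo hT] with t ht
      exact waveAt_eq_succ _ _ k i (h.pos t ht k hk).ne'
    have hmk : MeromorphicLeft (fun t => m t k) T := by
      refine MeromorphicLeft.congr ((hX.mul (hW (k + 1)).1).neg.div (hw k)) ?_
      filter_upwards [eventually_mem_Ioo hT] with t ht
      exact (h.eq_wave_succ ht (hm t ht) hk).2
    refine ⟨fun i => ?_, fun _ => ⟨hX, hmk⟩⟩
    cases i with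
    | zero =>
      simpa only [wave_succ_zero] using hW 0
    | succ i =>
      refine ⟨((hW (i + 1)).1.add ((hmk.div hX).mul (hw i))).congr ?_,
        ((hW (i + 1)).2.1.sub (((MeromorphicLeft.const 2).mul hmk).mul (hw i))).congr ?_,
        ((hW (i + 1)).2.2.add ((hmk.mul hX).mul (hw i))).congr ?_⟩ <;>
      · refine Eventually.of_forall fun t => ?_
        simp only [wave_succ_succ]
        ring

/-- The last position stays bounded above. -/
theorem OrderedFlow.exists_le_last {n : ℕ} {X m : ℝ → ℕ → ℝ} {T : ℝ} (hT : 0 < T)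
    (h : OrderedFlow (n + 1) X m T) (hm : ∀ t ∈ Ioo 0 T, ∀ k < n + 1, m t k ≠ 0) :
    ∃ b : ℝ, ∀ᶠ t in 𝓝[<] T, X t n ≤ b := by
  obtain ⟨a, ha⟩ := h.exists_wave_fst_eq (n + 1)
  obtain ⟨-, ⟨f, hf, ef⟩, -⟩ := h.exists_analyticAt_eqOn_wave (n + 1)
  have hlim : Tendsto (fun t => -f t / (2 * a)) (𝓝[<] T) (𝓝 (-f T / (2 * a))) :=
    ((hf T).continuousAt.tendsto.mono_left nhdsWithin_le_nhds).neg.div_const _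
  refine ⟨-f T / (2 * a) + 1, ?_⟩
  filter_upwards [hlim.eventually (gt_mem_nhds (lt_add_one _)), eventually_mem_Ioo hT] with t h1 ht
  rw [(h.eq_wave_succ ht (hm t ht) (Nat.lt_succ_self n)).1, ha t ht]
  have h2 : (wave (X t) (m t) (n + 1) (n + 1)).2.1 = f t := ef ht
  rw [h2]
  exact h1.le

/-- The reflection `x ↦ -x`, `m ↦ -m` with reversed labels maps solutions to solutions. -/
theorem OrderedFlow.reflect {n : ℕ} {X m : ℝ → ℕ → ℝ} {T : ℝ} (h : OrderedFlow n X m T) :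
    OrderedFlow n (fun t k => (X t (n - 1 - k))⁻¹) (fun t k => -m t (n - 1 - k)) T := by
  have hl : ∀ t, ∀ k < n, leftMoment (fun k => (X t (n - 1 - k))⁻¹) (fun k => -m t (n - 1 - k)) k
      = -rightMoment n (X t) (m t) (n - 1 - k + 1) := by
    intro t k hk
    rw [leftMoment, rightMoment, Finset.range_eq_Ico]
    have := Finset.sum_Ico_reflect (fun i => -m t i * (X t i)⁻¹) 0 (show k ≤ n - 1 + 1 by omega)
    rw [this, ← Finset.sum_neg_distrib, show n - 1 + 1 - k = n - 1 - k + 1 by omega,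
      show n - 1 + 1 - 0 = n by omega]
    exact Finset.sum_congr rfl fun i _ => by ring
  have hr : ∀ t, ∀ k < n,
      rightMoment n (fun k => (X t (n - 1 - k))⁻¹) (fun k => -m t (n - 1 - k)) (k + 1)
      = -leftMoment (X t) (m t) (n - 1 - k) := by
    intro t k hk
    rw [leftMoment, rightMoment, Finset.range_eq_Ico]
    have := Finset.sum_Ico_reflect (fun i => -m t i / (X t i)⁻¹) (k + 1)
      (show n ≤ n - 1 + 1 by omega)
    rw [this, ← Finset.sum_neg_distrib, show n - 1 + 1 - n = 0 by omega,
      show n - 1 + 1 - (k + 1) = n - 1 - k by omega]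
    exact Finset.sum_congr rfl fun i _ => by rw [div_inv_eq_mul]; ring
  refine ⟨fun t ht k hk => inv_pos.2 (h.pos t ht _ (by omega)), fun t ht k hk => ?_,
    fun t ht k hk => ?_, fun t ht k hk => ?_⟩
  · have h1 := h.lt_succ t ht (n - 1 - (k + 1)) (by omega)
    rw [show n - 1 - (k + 1) + 1 = n - 1 - k by omega] at h1
    exact inv_strictAnti₀ (h.pos t ht _ (by omega)) h1
  · have hX := (h.pos t ht (n - 1 - k) (by omega)).ne'
    refine ((h.hasDerivAt_X t ht (n - 1 - k) (by omega)).inv hX).congr_deriv ?_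
    simp only [hl t k hk, hr t k hk]
    field_simp
    ring
  · have hX := (h.pos t ht (n - 1 - k) (by omega)).ne'
    refine (h.hasDerivAt_m t ht (n - 1 - k) (by omega)).neg.congr_deriv ?_
    simp only [hl t k hk, hr t k hk]
    field_simp
    ring

theorem OrderedFlow.le_of_le {n : ℕ} {X m : ℝ → ℕ → ℝ} {T : ℝ} (h : OrderedFlow n X m T)
    {t : ℝ} (ht : t ∈ Ioo 0 T) {i j : ℕ} (hij : i ≤ j) (hj : j < n) : X t i ≤ X t j := by
  induction j, hij using Nat.le_induction with
  | base => exact le_rfl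
  | succ j _ ih => exact (ih (by omega)).trans (h.lt_succ t ht j hj).le

/-- Positions extend analytically across `T`, with finite values there. The first position stays
bounded below because the reflected flow has its last position bounded above. -/
theorem OrderedFlow.exists_analyticAt_X {n : ℕ} {X m : ℝ → ℕ → ℝ} {T : ℝ} (hT : 0 < T)
    (h : OrderedFlow n X m T) (hm : ∀ t ∈ Ioo 0 T, ∀ k < n, m t k ≠ 0) {k : ℕ} (hk : k < n) :
    ∃ F : ℝ → ℝ, AnalyticAt ℝ F T ∧ 0 < F T ∧ (fun t => X t k) =ᶠ[𝓝[<] T] F := by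
  obtain ⟨n, rfl⟩ := Nat.exists_eq_succ_of_ne_zero (Nat.ne_zero_of_lt hk)
  obtain ⟨b, hb⟩ := h.exists_le_last hT hm
  obtain ⟨b', hb'⟩ := h.reflect.exists_le_last hT fun t ht k _ =>
    neg_ne_zero.2 (hm t ht _ (by omega))
  have hb0 : 0 < b' := by
    obtain ⟨t, h1, ht⟩ := (hb'.and (eventually_mem_Ioo hT)).exists
    exact (h.reflect.pos t ht n (Nat.lt_succ_self n)).trans_le h1
  refine MeromorphicLeft.exists_analyticAt_of_bounded
    ((h.meromorphicLeft_wave hT hm hk.le).2 hk).1 (a := b'⁻¹) (b := b) (inv_pos.2 hb0) ?_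
  filter_upwards [hb, hb', eventually_mem_Ioo hT] with t h1 h2 ht
  refine ⟨le_trans ?_ (h.le_of_le ht (Nat.zero_le k) hk),
    (h.le_of_le ht (Nat.le_of_lt_succ hk) (Nat.lt_succ_self n)).trans h1⟩
  have h3 : (X t 0)⁻¹ ≤ b' := by simpa using h2
  exact inv_le_of_inv_le₀ (h.pos t ht 0 (by omega)) h3

/-! ### Orders of left germs -/

/-- To the left of `c`, `f` is `(t - c) ^ r` times an analytic function that does not vanish
at `c`. -/
def HasLeftOrder (f : ℝ → ℝ) (c : ℝ) (r : ℤ) : Prop :=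
  ∃ h : ℝ → ℝ, AnalyticAt ℝ h c ∧ h c ≠ 0 ∧ f =ᶠ[𝓝[<] c] fun t => (t - c) ^ r * h t

namespace HasLeftOrder

variable {f g : ℝ → ℝ} {c : ℝ} {r s : ℤ}

theorem congr (hf : HasLeftOrder f c r) (h : g =ᶠ[𝓝[<] c] f) : HasLeftOrder g c r := by
  obtain ⟨F, hF, h0, e⟩ := hf
  exact ⟨F, hF, h0, h.trans e⟩

theorem of_analyticAt (hf : AnalyticAt ℝ f c) (h0 : f c ≠ 0) : HasLeftOrder f c 0 :=
  ⟨f, hf, h0, Eventually.of_forall fun t => by simp⟩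

theorem sub_const (c : ℝ) : HasLeftOrder (fun t => t - c) c 1 :=
  ⟨fun _ => 1, analyticAt_const, one_ne_zero, Eventually.of_forall fun t => by simp⟩

theorem mul (hf : HasLeftOrder f c r) (hg : HasLeftOrder g c s) :
    HasLeftOrder (fun t => f t * g t) c (r + s) := by
  obtain ⟨F, hF, hF0, eF⟩ := hf
  obtain ⟨G, hG, hG0, eG⟩ := hg
  refine ⟨fun t => F t * G t, hF.mul hG, mul_ne_zero hF0 hG0, ?_⟩
  filter_upwards [eF, eG, self_mem_nhdsWithin] with t h1 h2 ht
  rw [h1, h2, zpow_add₀ (sub_ne_zero.2 (ne_of_lt ht))]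
  ring

theorem inv (hf : HasLeftOrder f c r) : HasLeftOrder (fun t => (f t)⁻¹) c (-r) := by
  obtain ⟨F, hF, hF0, eF⟩ := hf
  refine ⟨fun t => (F t)⁻¹, hF.inv hF0, inv_ne_zero hF0, ?_⟩
  filter_upwards [eF] with t h1
  rw [h1, mul_inv, zpow_neg]

theorem prod {ι : Type*} (S : Finset ι) {f : ι → ℝ → ℝ} {r : ι → ℤ}
    (h : ∀ i ∈ S, HasLeftOrder (f i) c (r i)) :
    HasLeftOrder (fun t => ∏ i ∈ S, f i t) c (∑ i ∈ S, r i) := by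
  classical
  induction S using Finset.induction_on with
  | empty => simpa using of_analyticAt (f := fun _ => (1 : ℝ)) analyticAt_const one_ne_zero
  | insert i S hi ih =>
    simp only [Finset.prod_insert hi, Finset.sum_insert hi]
    exact (h i (Finset.mem_insert_self i S)).mul
      (ih fun j hj => h j (Finset.mem_insert_of_mem hj))

theorem tendsto_zpow_zero (c : ℝ) {k : ℤ} (hk : 0 < k) :
    Tendsto (fun t => (t - c) ^ k) (𝓝[<] c) (𝓝 0) := by
  lift k to ℕ using hk.le
  have h1 : Tendsto (fun t : ℝ => (t - c) ^ k) (𝓝 c) (𝓝 ((c - c) ^ k)) :=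
    ((continuous_id.sub continuous_const).pow k).tendsto c
  rw [sub_self, zero_pow (by omega)] at h1
  simpa using h1.mono_left nhdsWithin_le_nhds

/-- A left germ of order `r` with a finite limit has `r ≥ 0`, and `r = 0` exactly when the limit
is not zero. -/
theorem of_tendsto (hf : HasLeftOrder f c r) {L : ℝ} (hL : Tendsto f (𝓝[<] c) (𝓝 L)) :
    (L ≠ 0 ∧ r = 0) ∨ (L = 0 ∧ 1 ≤ r) := by
  obtain ⟨F, hF, hF0, e⟩ := hf
  have hlim : Tendsto F (𝓝[<] c) (𝓝 (F c)) :=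
    hF.continuousAt.tendsto.mono_left nhdsWithin_le_nhds
  rcases lt_trichotomy r 0 with hr | rfl | hr
  · have h1 := (tendsto_zpow_zero c (neg_pos.2 hr)).mul hL
    rw [zero_mul] at h1
    have h2 : F =ᶠ[𝓝[<] c] fun t => (t - c) ^ (-r) * f t := by
      filter_upwards [e, self_mem_nhdsWithin] with t ht hlt
      have h0 : t - c ≠ 0 := sub_ne_zero.2 (ne_of_lt hlt)
      have := zpow_ne_zero r h0
      rw [ht, zpow_neg]
      field_simp
    exact absurd (tendsto_nhds_unique hlim (h1.congr' h2.symm)) hF0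
  · left
    have h1 : f =ᶠ[𝓝[<] c] F := e.trans (Eventually.of_forall fun t => by simp)
    rw [tendsto_nhds_unique (hL.congr' h1) hlim]
    exact ⟨hF0, rfl⟩
  · right
    have h1 := (tendsto_zpow_zero c hr).mul hlim
    rw [zero_mul] at h1
    exact ⟨tendsto_nhds_unique hL (h1.congr' e.symm), hr⟩

theorem tendsto_abs_atTop (hf : HasLeftOrder f c (-1)) :
    Tendsto (fun t => |f t|) (𝓝[<] c) atTop := by
  have h1 : HasLeftOrder (fun t => (f t)⁻¹) c 1 := by simpa using hf.inv
  obtain ⟨F, hF, hF0, e⟩ := h1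
  have hlim : Tendsto F (𝓝[<] c) (𝓝 (F c)) :=
    hF.continuousAt.tendsto.mono_left nhdsWithin_le_nhds
  have h2 := (tendsto_zpow_zero c one_pos).mul hlim
  rw [zero_mul] at h2
  have h3 : Tendsto (fun t => |(f t)⁻¹|) (𝓝[<] c) (𝓝[>] 0) := by
    refine tendsto_nhdsWithin_iff.2 ⟨by simpa using (h2.congr' e.symm).abs, ?_⟩
    filter_upwards [e, hlim.eventually_ne hF0, self_mem_nhdsWithin] with t h4 h5 h6
    rw [mem_Ioi, abs_pos, h4]
    exact mul_ne_zero (zpow_ne_zero _ (sub_ne_zero.2 (ne_of_lt h6))) h5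
  refine h3.inv_tendsto_nhdsGT_zero.congr fun t => ?_
  simp [abs_inv]

/-- The logarithmic derivative has at most a simple pole, whose residue is the order. -/
theorem tendsto_logDeriv (hf : HasLeftOrder f c r) {f' : ℝ → ℝ}
    (hd : ∀ᶠ t in 𝓝[<] c, HasDerivAt f (f' t) t) :
    Tendsto (fun t => (t - c) * (f' t / f t)) (𝓝[<] c) (𝓝 r) := by
  obtain ⟨F, hF, hF0, e⟩ := hf
  have hlim : Tendsto (fun t => (r : ℝ) + (t - c) * (deriv F t / F t)) (𝓝[<] c)
      (𝓝 ((r : ℝ) + (c - c) * (deriv F c / F c))) := by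
    have : ContinuousAt (fun t => (r : ℝ) + (t - c) * (deriv F t / F t)) c :=
      continuousAt_const.add ((continuousAt_id.sub continuousAt_const).mul
        (hF.deriv.continuousAt.div hF.continuousAt hF0))
    exact this.tendsto.mono_left nhdsWithin_le_nhds
  rw [sub_self, zero_mul, add_zero] at hlim
  refine hlim.congr' ?_
  have hne : ∀ᶠ t in 𝓝[<] c, F t ≠ 0 :=
    (hF.continuousAt.tendsto.mono_left nhdsWithin_le_nhds).eventually_ne hF0
  have hana : ∀ᶠ t in 𝓝[<] c, AnalyticAt ℝ F t :=
    hF.eventually_analyticAt.filter_mono nhdsWithin_le_nhds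
  have heq : ∀ᶠ t in 𝓝[<] c, f =ᶠ[𝓝 t] fun t => (t - c) ^ r * F t := by
    filter_upwards [eventually_eventually_nhdsWithin.2 e, self_mem_nhdsWithin] with t h1 h2
    rwa [isOpen_Iio.nhdsWithin_eq h2] at h1
  filter_upwards [hd, hne, hana, heq, self_mem_nhdsWithin] with t h1 h2 h3 h4 h5
  have h0 : t - c ≠ 0 := sub_ne_zero.2 (ne_of_lt h5)
  have h6 : HasDerivAt (fun t => (t - c) ^ r * F t)
      (r * (t - c) ^ (r - 1) * F t + (t - c) ^ r * deriv F t) t := by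
    exact ((hasDerivAt_zpow r (t - c) (Or.inl h0)).comp_sub_const t c).mul
      h3.differentiableAt.hasDerivAt
  rw [(h1.congr_of_eventuallyEq h4.symm).unique h6, h4.eq_of_nhds, zpow_sub_one₀ h0]
  have := zpow_ne_zero r h0
  field_simp

end HasLeftOrder

/-! ### Collisions -/

/-- Leading-order analysis of the peakon equations at `T`, with `C k` the limit of `X k`. The
residue of the velocity of each peakon vanishes, which forces the residues of the moments to vanish
in a gap that stays open. Every mass has at most a simple pole, and the mass of a peakon whose
limiting position is not shared by a neighbour has none. -/
theorem OrderedFlow.order_mass_ge {n : ℕ} {X m : ℝ → ℕ → ℝ} {T : ℝ} (hT : 0 < T)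
    (h : OrderedFlow n X m T) (hm : ∀ t ∈ Ioo 0 T, ∀ k < n, m t k ≠ 0) {C : ℕ → ℝ} {α : ℕ → ℤ}
    (hC : ∀ k < n, 0 < C k) (hXC : ∀ k < n, Tendsto (fun t => X t k) (𝓝[<] T) (𝓝 (C k)))
    (hX : ∀ k < n, HasLeftOrder (fun t => X t k) T 0)
    (hα : ∀ k < n, HasLeftOrder (fun t => m t k) T (α k)) {k : ℕ} (hk : k < n) :
    -1 ≤ α k ∧
    ((k = 0 ∨ C (k - 1) ≠ C k) → (k + 1 = n ∨ C k ≠ C (k + 1)) → 0 ≤ α k) := by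
  have hmem := eventually_mem_Ioo hT
  -- The residue of the velocity is zero, that of `m' / m` is the order of the mass.
  have hv : ∀ j < n, Tendsto (fun t => (t - T) * (leftMoment (X t) (m t) j / X t j + m t j
      + rightMoment n (X t) (m t) (j + 1) * X t j)) (𝓝[<] T) (𝓝 0) := by
    intro j hj
    have := (hX j hj).tendsto_logDeriv (hmem.mono fun t ht => h.hasDerivAt_X t ht j hj)
    rw [Int.cast_zero] at this
    refine this.congr' ?_
    filter_upwards [hmem] with t ht
    have := (h.pos t ht j hj).ne'
    field_simp
  have hw : ∀ j < n, Tendsto (fun t => (t - T) * (2 * (leftMoment (X t) (m t) j / X t j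
      - rightMoment n (X t) (m t) (j + 1) * X t j))) (𝓝[<] T) (𝓝 (α j)) := by
    intro j hj
    refine ((hα j hj).tendsto_logDeriv
      (hmem.mono fun t ht => h.hasDerivAt_m t ht j hj)).congr' ?_
    filter_upwards [hmem] with t ht
    have := hm t ht j hj
    have := (h.pos t ht j hj).ne'
    field_simp
  have hstep : ∀ j < n, ∀ l : ℝ,
      Tendsto (fun t => (t - T) * leftMoment (X t) (m t) j) (𝓝[<] T) (𝓝 l) →
      Tendsto (fun t => (t - T) * m t j) (𝓝[<] T) (𝓝 (0 + (α j : ℝ) / 2 - 2 * (l / C j))) := by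
    intro j hj l hl
    refine (((hv j hj).add ((hw j hj).div_const 2)).sub
      ((hl.div (hXC j hj) (hC j hj).ne').const_mul 2)).congr fun t => ?_
    simp only [Pi.div_apply]
    ring
  have hL : ∀ j ≤ n, ∃ l : ℝ,
      Tendsto (fun t => (t - T) * leftMoment (X t) (m t) j) (𝓝[<] T) (𝓝 l) := by
    intro j hj
    induction j with
    | zero => exact ⟨0, by simp [leftMoment]⟩
    | succ j ih =>
      obtain ⟨l, hl⟩ := ih (by omega)
      refine ⟨_, (hl.add ((hstep j hj l hl).mul (hXC j hj))).congr fun t => ?_⟩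
      rw [leftMoment_succ]
      ring
  choose! l hl using hL
  have hμ : ∀ j < n, ∃ μ : ℝ, Tendsto (fun t => (t - T) * m t j) (𝓝[<] T) (𝓝 μ) :=
    fun j hj => ⟨_, hstep j hj _ (hl j hj.le)⟩
  choose! μ hμ using hμ
  have hl_succ : ∀ j < n, l (j + 1) = l j + μ j * C j := by
    intro j hj
    refine tendsto_nhds_unique (hl (j + 1) hj)
      (((hl j hj.le).add ((hμ j hj).mul (hXC j hj))).congr fun t => ?_)
    rw [leftMoment_succ]
    ring
  -- On either side of a peakon the residue `l` of the left moment determines that of the right one.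
  have hR : ∀ j < n, Tendsto (fun t => (t - T) * rightMoment n (X t) (m t) (j + 1)) (𝓝[<] T)
      (𝓝 (-l (j + 1) / C j ^ 2)) := by
    intro j hj
    have h1 := (((hv j hj).sub ((hl j hj.le).div (hXC j hj) (hC j hj).ne')).sub (hμ j hj)).div
      (hXC j hj) (hC j hj).ne'
    have hCj := (hC j hj).ne'
    have e : (0 - l j / C j - μ j) / C j = -l (j + 1) / C j ^ 2 := by
      rw [hl_succ j hj]
      field_simp
      ring
    rw [e] at h1
    refine h1.congr' ?_
    filter_upwards [hmem] with t ht
    have := (h.pos t ht j hj).ne'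
    simp only [Pi.div_apply]
    field_simp
    ring
  have hR' : ∀ j < n, Tendsto (fun t => (t - T) * rightMoment n (X t) (m t) j) (𝓝[<] T)
      (𝓝 (-l j / C j ^ 2)) := by
    intro j hj
    have h1 := (hR j hj).add ((hμ j hj).div (hXC j hj) (hC j hj).ne')
    have hCj := (hC j hj).ne'
    have e : -l (j + 1) / C j ^ 2 + μ j / C j = -l j / C j ^ 2 := by
      rw [hl_succ j hj]
      field_simp
      ring
    rw [e] at h1
    refine h1.congr fun t => ?_
    rw [rightMoment_eq_add n (X t) (m t) hj]
    simp only [Pi.div_apply]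
    ring
  have hl_zero : l 0 = 0 := tendsto_nhds_unique (hl 0 (Nat.zero_le n)) (by simp [leftMoment])
  have hl_last : ∀ j, j + 1 = n → l (j + 1) = 0 := by
    rintro j rfl
    have h1 := tendsto_nhds_unique (hR j (Nat.lt_succ_self j)) (b := 0) (by simp [rightMoment_self])
    have hCj := (hC j (Nat.lt_succ_self j)).ne'
    simpa [hCj] using h1
  have hl_gap : ∀ j, j + 1 < n → C j ≠ C (j + 1) → l (j + 1) = 0 := by
    intro j hj hne
    have h1 := tendsto_nhds_unique (hR j (by omega)) (hR' (j + 1) hj)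
    have hj0 := hC j (by omega)
    have hj1 := hC (j + 1) hj
    rw [div_eq_div_iff (by positivity) (by positivity)] at h1
    have h2 : l (j + 1) * ((C j - C (j + 1)) * (C j + C (j + 1))) = 0 := by linear_combination h1
    exact (mul_eq_zero.1 h2).resolve_right (mul_ne_zero (sub_ne_zero.2 hne) (by positivity))
  have key := ((HasLeftOrder.sub_const T).mul (hα k hk)).of_tendsto (hμ k hk)
  refine ⟨by omega, fun h1 h2 => ?_⟩
  have hk0 : l k = 0 := by
    rcases h1 with rfl | h1
    · exact hl_zero
    · rcases Nat.eq_zero_or_pos k with rfl | hpos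
      · exact hl_zero
      · have := hl_gap (k - 1) (by omega)
        rw [Nat.sub_add_cancel hpos] at this
        exact this h1
  have hk1 : l (k + 1) = 0 := by
    rcases h2 with h2 | h2
    · exact hl_last k h2
    · by_cases h3 : k + 1 = n
      · exact hl_last k h3
      · exact hl_gap k (by omega) h2
  have h3 := hl_succ k hk
  rw [hk0, hk1, zero_add] at h3
  have h4 : μ k = 0 := (mul_eq_zero.1 h3.symm).resolve_right (hC k hk).ne'
  rcases key with ⟨h5, -⟩ | ⟨-, h5⟩
  · exact absurd h4 h5
  · omega

/-- Conservation of the constant of motion of highest degree, in terms of orders at `T`. -/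
theorem OrderedFlow.sum_order_eq_zero {n : ℕ} {X m : ℝ → ℕ → ℝ} {T : ℝ} (hT : 0 < T)
    (h : OrderedFlow (n + 1) X m T) (hm : ∀ t ∈ Ioo 0 T, ∀ k < n + 1, m t k ≠ 0)
    {α γ : ℕ → ℤ} (hX : ∀ k < n + 1, HasLeftOrder (fun t => X t k) T 0)
    (hα : ∀ k < n + 1, HasLeftOrder (fun t => m t k) T (α k))
    (hγ : ∀ k < n, HasLeftOrder (fun t => X t (k + 1) - X t k) T (γ k)) :
    ∑ k ∈ Finset.range (n + 1), α k + 2 * ∑ k ∈ Finset.range n, γ k = 0 := by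
  obtain ⟨a, ha⟩ := h.exists_wave_fst_eq (n + 1)
  have ha0 : a ≠ 0 := by
    obtain ⟨t, ht⟩ := (eventually_mem_Ioo hT).exists
    rw [← ha t ht]
    exact h.wave_leading_ne_zero ht (hm t ht) (Nat.lt_succ_self n)
  have h1 := (HasLeftOrder.of_analyticAt (c := T) (f := fun _ => (-1 : ℝ) ^ (n + 1))
      analyticAt_const (pow_ne_zero _ (by norm_num))).mul
    ((HasLeftOrder.prod (Finset.range (n + 1)) fun k hk => hα k (Finset.mem_range.1 hk)).mul
    (HasLeftOrder.prod (Finset.range n) fun k hk =>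
      ((hγ k (Finset.mem_range.1 hk)).mul
        (hX (k + 1) (by have := Finset.mem_range.1 hk; omega)).inv).mul
      ((hγ k (Finset.mem_range.1 hk)).mul
        (hX (k + 1) (by have := Finset.mem_range.1 hk; omega)).inv)))
  have h2 := h1.of_tendsto (L := a) (tendsto_const_nhds.congr' (by
    filter_upwards [eventually_mem_Ioo hT] with t ht
    rw [← ha t ht, wave_leading_eq_prod _ _ _ fun j hj => (h.pos t ht j (by omega)).ne', mul_assoc]
    congr 2
    refine Finset.prod_congr rfl fun j hj => ?_
    have := (h.pos t ht (j + 1) (by have := Finset.mem_range.1 hj; omega)).ne'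
    field_simp))
  rcases h2 with ⟨-, h2⟩ | ⟨h2, -⟩
  · rw [zero_add] at h2
    rw [← h2, Finset.mul_sum]
    congr 1
    exact Finset.sum_congr rfl fun k _ => by ring
  · exact absurd h2 ha0

/-- Two neighbours with a common limiting position have masses with a simple pole, their distance
has a simple zero, and no third peakon joins them. Weighting each mass by its order plus the
orders of the adjacent gaps gives nonnegative numbers whose sum vanishes. -/
theorem OrderedFlow.orders_of_collision {n : ℕ} {X m : ℝ → ℕ → ℝ} {T : ℝ} (hT : 0 < T)
    (h : OrderedFlow n X m T) (hm : ∀ t ∈ Ioo 0 T, ∀ k < n, m t k ≠ 0) {C : ℕ → ℝ}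
    (hXC : ∀ k < n, Tendsto (fun t => X t k) (𝓝[<] T) (𝓝 (C k)))
    {k : ℕ} (hk : k + 1 < n) (hck : C k = C (k + 1)) :
    HasLeftOrder (fun t => m t k) T (-1) ∧ HasLeftOrder (fun t => m t (k + 1)) T (-1) ∧
    HasLeftOrder (fun t => X t (k + 1) - X t k) T 1 ∧ (k + 2 < n → C (k + 1) ≠ C (k + 2)) := by
  obtain ⟨n, rfl⟩ := Nat.exists_eq_succ_of_ne_zero (Nat.ne_zero_of_lt hk)
  have hmem := eventually_mem_Ioo hT
  have hX : ∀ j < n + 1, 0 < C j ∧ HasLeftOrder (fun t => X t j) T 0 := by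
    intro j hj
    obtain ⟨F, hF, hpos, e⟩ := h.exists_analyticAt_X hT hm hj
    refine ⟨?_, (HasLeftOrder.of_analyticAt hF hpos.ne').congr e⟩
    rwa [tendsto_nhds_unique (hXC j hj)
      ((hF.continuousAt.tendsto.mono_left nhdsWithin_le_nhds).congr' e.symm)]
  have hα : ∀ j < n + 1, ∃ r, HasLeftOrder (fun t => m t j) T r := fun j hj =>
    ((h.meromorphicLeft_wave hT hm hj.le).2 hj).2.exists_eq_zpow_mul
      (hmem.mono fun t ht => hm t ht j hj)
  have hγ : ∀ j < n, ∃ r, HasLeftOrder (fun t => X t (j + 1) - X t j) T r := fun j hj =>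
    (((h.meromorphicLeft_wave hT hm (k := j + 1) (by omega)).2 (by omega)).1.sub
      ((h.meromorphicLeft_wave hT hm (k := j) (by omega)).2 (by omega)).1).exists_eq_zpow_mul
      (hmem.mono fun t ht => (sub_pos.2 (h.lt_succ t ht j (by omega))).ne')
  choose! α hα using hα
  choose! γ hγ using hγ
  have hγC : ∀ j < n, (C j ≠ C (j + 1) ∧ γ j = 0) ∨ (C j = C (j + 1) ∧ 1 ≤ γ j) := by
    intro j hj
    have := (hγ j hj).of_tendsto ((hXC (j + 1) (by omega)).sub (hXC j (by omega)))
    rw [sub_ne_zero, sub_eq_zero, ne_comm, eq_comm (a := C (j + 1))] at this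
    exact this
  -- `δ j` is the order of the gap before the peakon `j`.
  let δ : ℕ → ℤ := fun j => if j = 0 ∨ n < j then 0 else γ (j - 1)
  have hδ : ∀ j < n, δ (j + 1) = γ j := fun j hj => by
    simp only [δ]
    rw [if_neg (by omega), Nat.add_sub_cancel]
  have hδ0 : δ 0 = 0 := if_pos (Or.inl rfl)
  have hδn : δ (n + 1) = 0 := if_pos (Or.inr (Nat.lt_succ_self n))
  have hsum : ∑ j ∈ Finset.range (n + 1), (α j + (δ j + δ (j + 1))) = 0 := by
    have h1 := h.sum_order_eq_zero hT hm (fun j hj => (hX j hj).2) hα hγ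
    rw [Finset.sum_add_distrib, Finset.sum_add_distrib, Finset.sum_range_succ' δ,
      Finset.sum_range_succ (fun j => δ (j + 1)), hδ0, hδn,
      Finset.sum_congr rfl fun j hj => hδ j (Finset.mem_range.1 hj)]
    linear_combination h1
  have hnonneg : ∀ j ∈ Finset.range (n + 1),
      0 ≤ α j + (δ j + δ (j + 1)) ∧ -1 ≤ α j ∧ 0 ≤ δ j ∧ 0 ≤ δ (j + 1) := by
    intro j hj
    have hj : j < n + 1 := Finset.mem_range.1 hj
    obtain ⟨h1, h2⟩ := h.order_mass_ge hT hm (fun j hj => (hX j hj).1) hXC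
      (fun j hj => (hX j hj).2) hα hj
    have h3 : ((j = 0 ∨ C (j - 1) ≠ C j) ∧ 0 ≤ δ j) ∨ 1 ≤ δ j := by
      rcases j with _ | j
      · exact Or.inl ⟨Or.inl rfl, hδ0.ge⟩
      · rw [hδ j (by omega)]
        rcases hγC j (by omega) with h4 | h4
        · exact Or.inl ⟨Or.inr h4.1, h4.2.ge⟩
        · exact Or.inr h4.2
    have h4 : ((j + 1 = n + 1 ∨ C j ≠ C (j + 1)) ∧ 0 ≤ δ (j + 1)) ∨ 1 ≤ δ (j + 1) := by
      by_cases hjn : j = n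
      · subst hjn
        exact Or.inl ⟨Or.inl rfl, hδn.ge⟩
      · rw [hδ j (by omega)]
        rcases hγC j (by omega) with h4 | h4
        · exact Or.inl ⟨Or.inr h4.1, h4.2.ge⟩
        · exact Or.inr h4.2
    rcases h3 with ⟨h3, h3'⟩ | h3 <;> rcases h4 with ⟨h4, h4'⟩ | h4
    · have := h2 h3 h4
      omega
    all_goals omega
  have hzero := (Finset.sum_eq_zero_iff_of_nonneg fun j hj => (hnonneg j hj).1).1 hsum
  have hk0 : k ∈ Finset.range (n + 1) := Finset.mem_range.2 (by omega)
  have hk1 : k + 1 ∈ Finset.range (n + 1) := Finset.mem_range.2 (by omega)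
  have e0 := hzero k hk0
  have e1 := hzero (k + 1) hk1
  have b0 := hnonneg k hk0
  have b1 := hnonneg (k + 1) hk1
  have hg : 1 ≤ γ k := by
    rcases hγC k (by omega) with h4 | h4
    · exact absurd hck h4.1
    · exact h4.2
  rw [hδ k (by omega)] at e0 e1 b0 b1
  have a0 : α k = -1 := by omega
  have a1 : α (k + 1) = -1 := by omega
  have g0 : γ k = 1 := by omega
  refine ⟨a0 ▸ hα k (by omega), a1 ▸ hα (k + 1) (by omega), g0 ▸ hγ k (by omega),
    fun hk2 hne => ?_⟩
  have hk2 : k + 1 < n := by omega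
  rw [hδ (k + 1) hk2] at e1
  rcases hγC (k + 1) hk2 with h4 | h4
  · exact h4.1 hne
  · omega

/-! ### From the peakon equations to the ordered flow -/

/-- The exponentials `exp (x k)` of the positions, as a function of a natural number label; the
value at labels `k ≥ n` is `0`. -/
noncomputable def expPosition {n : ℕ} (x : Fin n → ℝ) (k : ℕ) : ℝ :=
  if h : k < n then Real.exp (x ⟨k, h⟩) else 0

/-- The masses as a function of a natural number label; the value at labels `k ≥ n` is `0`. -/
def extendMass {n : ℕ} (m : Fin n → ℝ) (k : ℕ) : ℝ :=
  if h : k < n then m ⟨k, h⟩ else 0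

theorem expPosition_of_lt {n : ℕ} (x : Fin n → ℝ) {k : ℕ} (h : k < n) :
    expPosition x k = Real.exp (x ⟨k, h⟩) := dif_pos h

theorem extendMass_of_lt {n : ℕ} (m : Fin n → ℝ) {k : ℕ} (h : k < n) :
    extendMass m k = m ⟨k, h⟩ := dif_pos h

/-- A sum over all labels, split at the label `k`. -/
theorem sum_fin_eq_left_add_right {n : ℕ} {x m : Fin n → ℝ} (k : Fin n) (s : ℝ)
    (f : Fin n → ℝ) (hlt : ∀ i < k, f i = m i * Real.exp (x i) / Real.exp (x k))
    (hgt : ∀ i > k, f i = s * (m i / Real.exp (x i) * Real.exp (x k))) :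
    ∑ i, f i = leftMoment (expPosition x) (extendMass m) k / expPosition x k + f k
      + s * (rightMoment n (expPosition x) (extendMass m) (k + 1) * expPosition x k) := by
  have e : ∑ i, f i = ∑ i ∈ Finset.range n, (if h : i < n then f ⟨i, h⟩ else 0) := by
    rw [Finset.sum_range]
    exact Finset.sum_congr rfl fun i _ => by simp
  rw [e, ← Finset.sum_range_add_sum_Ico _ k.2.le, Finset.sum_eq_sum_Ico_succ_bot k.2, leftMoment,
    rightMoment, Finset.sum_div, Finset.sum_mul, Finset.mul_sum, expPosition_of_lt x k.2,
    dif_pos k.2, ← add_assoc]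
  congr 1
  · congr 1
    refine Finset.sum_congr rfl fun i hi => ?_
    have hi' : i < k := Finset.mem_range.1 hi
    have hn : i < n := hi'.trans k.2
    rw [dif_pos hn, expPosition_of_lt x hn, extendMass_of_lt m hn, hlt ⟨i, hn⟩ hi']
  · refine Finset.sum_congr rfl fun i hi => ?_
    obtain ⟨hi', hn⟩ := Finset.mem_Ico.1 hi
    rw [dif_pos hn, expPosition_of_lt x hn, extendMass_of_lt m hn, hgt ⟨i, hn⟩ hi']

theorem profile_eq_moments {n : ℕ} {x : Fin n → ℝ} (m : Fin n → ℝ) (hx : StrictMono x)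
    (k : Fin n) : profile x m (x k) =
      leftMoment (expPosition x) (extendMass m) k / expPosition x k + extendMass m k
      + rightMoment n (expPosition x) (extendMass m) (k + 1) * expPosition x k := by
  rw [profile, sum_fin_eq_left_add_right (x := x) (m := m) k 1]
  · rw [extendMass_of_lt m k.2]
    simp
  · intro i hi
    rw [abs_of_pos (sub_pos.2 (hx hi)), neg_sub, Real.exp_sub, mul_div_assoc]
  · intro i hi
    rw [abs_of_neg (sub_neg.2 (hx hi)), neg_neg, Real.exp_sub]
    ring

theorem massRate_eq_moments {n : ℕ} {x : Fin n → ℝ} (m : Fin n → ℝ) (hx : StrictMono x)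
    (k : Fin n) : massRate x m k =
      2 * extendMass m k * (leftMoment (expPosition x) (extendMass m) k / expPosition x k
      - rightMoment n (expPosition x) (extendMass m) (k + 1) * expPosition x k) := by
  rw [massRate, sum_fin_eq_left_add_right (x := x) (m := m) k (-1)]
  · rw [extendMass_of_lt m k.2]
    simp only [sub_self, Real.sign_zero]
    ring
  · intro i hi
    rw [abs_of_pos (sub_pos.2 (hx hi)), neg_sub, Real.exp_sub,
      Real.sign_of_pos (sub_pos.2 (hx hi))]
    ring
  · intro i hi
    rw [abs_of_neg (sub_neg.2 (hx hi)), neg_neg, Real.exp_sub,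
      Real.sign_of_neg (sub_neg.2 (hx hi))]
    ring

/-- In exponential coordinates a peakon solution is an ordered flow as long as its positions stay
in their initial order. -/
theorem IsPeakonSolution.orderedFlow {n : ℕ} {x m : ℝ → Fin n → ℝ} {T S : ℝ}
    (h : IsPeakonSolution x m T) (hST : S ≤ T) (hmono : ∀ t ∈ Ioo 0 S, StrictMono (x t)) :
    OrderedFlow n (fun t => expPosition (x t)) (fun t => extendMass (m t)) S := by
  have hsub : ∀ t ∈ Ioo 0 S, t ∈ Ioo 0 T := fun t ht => ⟨ht.1, ht.2.trans_le hST⟩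
  refine ⟨fun t _ k hk => ?_, fun t ht k hk => ?_, fun t ht k hk => ?_, fun t ht k hk => ?_⟩
  · rw [expPosition_of_lt _ hk]
    exact Real.exp_pos _
  · rw [expPosition_of_lt _ hk, expPosition_of_lt _ (by omega : k < n)]
    exact Real.exp_lt_exp.2 (hmono t ht (Nat.lt_succ_self k))
  · have h1 := (h.hasDerivAt_position t (hsub t ht) ⟨k, hk⟩).exp
    rw [profile_eq_moments (m t) (hmono t ht) ⟨k, hk⟩] at h1
    simpa only [expPosition_of_lt _ hk] using h1
  · have h1 := h.hasDerivAt_mass t (hsub t ht) ⟨k, hk⟩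
    rw [massRate_eq_moments (m t) (hmono t ht) ⟨k, hk⟩] at h1
    simpa only [extendMass_of_lt _ hk] using h1

/-! ### Persistence of the ordering -/

theorem constantOfMotion_top {n : ℕ} (x m : Fin (n + 1) → ℝ) :
    constantOfMotion (n + 1) x m =
      (∏ i, m i) * ∏ j : Fin n, (1 - Real.exp (x j.castSucc - x j.succ)) ^ 2 := by
  have hid : ∀ I : Fin (n + 1) ↪o Fin (n + 1), I = RelEmbedding.refl _ := by
    intro I
    have := Subsingleton.elim 
      (RelIso.ofSurjective I (Finite.surjective_of_injective I.injective)) (OrderIso.refl _)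
    ext i
    exact congrArg Fin.val (DFunLike.congr_fun this i)
  let _ : Fintype (Fin (n + 1) ↪o Fin (n + 1)) := Fintype.ofFinite _
  exact Fintype.sum_eq_single (RelEmbedding.refl _) fun I hI => absurd (hid I) hI

theorem wave_leading_eq_constantOfMotion {n : ℕ} (x m : Fin (n + 1) → ℝ) :
    (wave (expPosition x) (extendMass m) (n + 1) (n + 1)).1
      = (-1) ^ (n + 1) * constantOfMotion (n + 1) x m := by
  rw [wave_leading_eq_prod _ _ _ fun j hj => by
    rw [expPosition_of_lt x (Nat.lt_succ_of_le hj)]; exact (Real.exp_pos _).ne',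
    constantOfMotion_top, mul_assoc, Finset.prod_range, Finset.prod_range]
  congr 2
  · exact Finset.prod_congr rfl fun i _ => extendMass_of_lt m i.2
  · refine Finset.prod_congr rfl fun j _ => ?_
    rw [expPosition_of_lt x (by omega : (j : ℕ) < n + 1),
      expPosition_of_lt x (by omega : (j : ℕ) + 1 < n + 1), ← Real.exp_sub]
    rfl

theorem IsPeakonSolution.continuousOn_constantOfMotion {n : ℕ} {x m : ℝ → Fin (n + 1) → ℝ} {T : ℝ}
    (h : IsPeakonSolution x m T) :
    ContinuousOn (fun t => constantOfMotion (n + 1) (x t) (m t)) (Ico 0 T) := by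
  simp only [constantOfMotion_top]
  refine (continuousOn_finsetProd _ fun i _ => h.continuousOn_mass i).mul
    (continuousOn_finsetProd _ fun j _ => (continuousOn_const.sub ?_).pow 2)
  exact ((h.continuousOn_position _).sub (h.continuousOn_position _)).rexp

/-- As long as the positions stay ordered, the constant of motion of highest degree is
conserved, up to and including a final time `S < T`. -/
theorem IsPeakonSolution.constantOfMotion_eq {n : ℕ} {x m : ℝ → Fin (n + 1) → ℝ} {T S : ℝ}
    (h : IsPeakonSolution x m T) (hS : 0 < S) (hST : S ≤ T)
    (hmono : ∀ t ∈ Ioo 0 S, StrictMono (x t)) {t : ℝ} (ht : t ∈ Icc 0 S) (htT : t < T) :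
    constantOfMotion (n + 1) (x t) (m t) = constantOfMotion (n + 1) (x 0) (m 0) := by
  obtain ⟨a, ha⟩ := (h.orderedFlow hST hmono).exists_wave_fst_eq (n + 1)
  have heq : EqOn (fun t => (-1) ^ (n + 1) * constantOfMotion (n + 1) (x t) (m t))
      (fun _ => a) (Ioo 0 S) := fun t ht => by
    rw [← ha t ht, wave_leading_eq_constantOfMotion]
  have heq' := heq.of_subset_closure (t := Icc 0 S ∩ Ico 0 T)
    ((continuousOn_const.mul h.continuousOn_constantOfMotion).mono inter_subset_right)
    continuousOn_const
    (fun t ht => ⟨Ioo_subset_Icc_self ht, ht.1.le, ht.2.trans_le hST⟩)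
    (by rw [closure_Ioo hS.ne]; exact inter_subset_left)
  have h1 := heq' ⟨ht, ht.1, htT⟩
  have h0 := heq' ⟨⟨le_rfl, hS.le⟩, ⟨le_rfl, hS.trans_le hST⟩⟩
  exact mul_left_cancel₀ (pow_ne_zero (n + 1) (by norm_num)) (h1.trans h0.symm)

/-- Positions cannot cross before `T`: at a first crossing the conserved quantity would
vanish. -/
theorem IsPeakonSolution.strictMono {n : ℕ} {x m : ℝ → Fin (n + 1) → ℝ} {T : ℝ}
    (h : IsPeakonSolution x m T) (hM : constantOfMotion (n + 1) (x 0) (m 0) ≠ 0)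
    {t : ℝ} (ht : t ∈ Ico 0 T) : StrictMono (x t) := by
  by_contra hbad
  have hsub : Icc 0 t ⊆ Ico 0 T := fun s hs => ⟨hs.1, hs.2.trans_lt ht.2⟩
  have hcpt : IsCompact {s ∈ Icc 0 t | ¬ StrictMono (x s)} := by
    refine isCompact_Icc.of_isClosed_subset ?_ fun s hs => hs.1
    have e : {s ∈ Icc 0 t | ¬ StrictMono (x s)}
        = ⋃ i : Fin n, {s ∈ Icc 0 t | x s i.succ ≤ x s i.castSucc} := by
      ext s
      simp [Fin.strictMono_iff_lt_succ]
    rw [e]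
    exact isClosed_iUnion_of_finite fun i => isClosed_Icc.isClosed_le
      ((h.continuousOn_position _).mono hsub) ((h.continuousOn_position _).mono hsub)
  obtain ⟨S, ⟨hSt, hS⟩, hleast⟩ := hcpt.exists_isLeast ⟨t, ⟨ht.1, le_rfl⟩, hbad⟩
  have hS0 : 0 < S := hSt.1.lt_of_ne fun h0 => hS (h0 ▸ h.strictMono_initial)
  have hST : S < T := hSt.2.trans_lt ht.2
  have hmono : ∀ s ∈ Ioo 0 S, StrictMono (x s) := fun s hs => by
    by_contra hs'
    exact absurd (hleast ⟨⟨hs.1.le, hs.2.le.trans hSt.2⟩, hs'⟩) (not_le.2 hs.2)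
  have hK := h.constantOfMotion_eq hS0 hST.le hmono ⟨hS0.le, le_rfl⟩ hST
  rw [← hK, constantOfMotion_top] at hM
  refine hS (Fin.strictMono_iff_lt_succ.2 fun i => lt_of_le_of_ne ?_ fun heq => ?_)
  · have hc : ∀ k, Tendsto (fun s => x s k) (𝓝[<] S) (𝓝 (x S k)) := fun k =>
      ((h.continuousOn_position k).continuousAt (Ico_mem_nhds hS0 hST)).tendsto.mono_left
        nhdsWithin_le_nhds
    refine le_of_tendsto_of_tendsto (hc _) (hc _) ?_
    filter_upwards [eventually_mem_Ioo hS0] with s hs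
    exact (hmono s hs Fin.castSucc_lt_succ).le
  · refine right_ne_zero_of_mul hM (Finset.prod_eq_zero (Finset.mem_univ i) ?_)
    rw [heq]
    simp

theorem IsPeakonSolution.mass_ne_zero {n : ℕ} {x m : ℝ → Fin (n + 1) → ℝ} {T : ℝ}
    (h : IsPeakonSolution x m T) (hM : constantOfMotion (n + 1) (x 0) (m 0) ≠ 0)
    {t : ℝ} (ht : t ∈ Ico 0 T) (i : Fin (n + 1)) : m t i ≠ 0 := by
  rw [← h.constantOfMotion_eq (ht.1.trans_lt ht.2) le_rfl
    (fun s hs => h.strictMono hM ⟨hs.1.le, hs.2⟩) ⟨ht.1, ht.2.le⟩ ht.2, constantOfMotion_top] at hM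
  exact Finset.prod_ne_zero_iff.1 (left_ne_zero_of_mul hM) i (Finset.mem_univ i)

/-! ### Collisions of peakons -/

/-- A function with a zero of left order one has a nonzero derivative there. -/
theorem HasLeftOrder.deriv_ne_zero {f : ℝ → ℝ} {c : ℝ} (hf : HasLeftOrder f c 1)
    (hd : DifferentiableAt ℝ f c) (h0 : f c = 0) : deriv f c ≠ 0 := by
  obtain ⟨F, hF, hF0, e⟩ := hf
  have h1 : Tendsto (slope f c) (𝓝[<] c) (𝓝 (deriv f c)) :=
    (hasDerivAt_iff_tendsto_slope.1 hd.hasDerivAt).mono_left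
      (nhdsWithin_mono _ fun t ht => ne_of_lt ht)
  have h2 : Tendsto F (𝓝[<] c) (𝓝 (F c)) :=
    hF.continuousAt.tendsto.mono_left nhdsWithin_le_nhds
  have h3 : slope f c =ᶠ[𝓝[<] c] F := by
    filter_upwards [e, self_mem_nhdsWithin] with t ht hlt
    have h4 : t - c ≠ 0 := sub_ne_zero.2 (ne_of_lt hlt)
    rw [slope_def_field, h0, ht, zpow_one]
    field_simp
    ring
  rwa [tendsto_nhds_unique h1 (h2.congr' h3.symm)]

/-- Two peakons with a common limiting position are neighbours, both masses have a simple pole,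
and their distance has a simple zero. -/
theorem IsPeakonSolution.collision {n : ℕ} {x m : ℝ → Fin (n + 1) → ℝ} {T : ℝ} (hT : 0 < T)
    (h : IsPeakonSolution x m T) (hM : constantOfMotion (n + 1) (x 0) (m 0) ≠ 0)
    {i j : Fin (n + 1)} (hij : i < j) {c : ℝ}
    (hi : Tendsto (fun t => x t i) (𝓝[<] T) (𝓝 c))
    (hj : Tendsto (fun t => x t j) (𝓝[<] T) (𝓝 c)) :
    (j : ℕ) = i + 1 ∧ HasLeftOrder (fun t => m t i) T (-1) ∧
    HasLeftOrder (fun t => m t j) T (-1) ∧ HasSimpleZeroAt (fun t => |x t i - x t j|) T := by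
  have hflow := h.orderedFlow le_rfl fun t ht => h.strictMono hM (Ioo_subset_Ico_self ht)
  have hm : ∀ t ∈ Ioo 0 T, ∀ k < n + 1, extendMass (m t) k ≠ 0 := fun t ht k hk => by
    rw [extendMass_of_lt _ hk]
    exact h.mass_ne_zero hM (Ioo_subset_Ico_self ht) _
  have hmem := eventually_mem_Ioo hT
  have hξ := fun k hk => hflow.exists_analyticAt_X hT hm (k := k) hk
  choose! ξ hξ hξ0 hξX using hξ
  have hlim : ∀ k < n + 1, Tendsto (fun t => expPosition (x t) k) (𝓝[<] T) (𝓝 (ξ k T)) :=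
    fun k hk => ((hξ k hk).continuousAt.tendsto.mono_left nhdsWithin_le_nhds).congr' (hξX k hk).symm
  have hC : ∀ k, Tendsto (fun t => x t k) (𝓝[<] T) (𝓝 c) → ξ k T = Real.exp c := fun k hk => by
    refine tendsto_nhds_unique (hlim k k.2) (hk.rexp.congr fun t => ?_)
    rw [expPosition_of_lt _ k.2]
  have hle : ∀ k l, k ≤ l → l < n + 1 → ξ k T ≤ ξ l T := fun k l hkl hl => by
    refine le_of_tendsto_of_tendsto (hlim k (by omega)) (hlim l hl) ?_
    filter_upwards [hmem] with t ht
    exact hflow.le_of_le ht hkl hl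
  have hCi := hC i hi
  have hCj := hC j hj
  have hlt : (i : ℕ) < j := hij
  -- Every peakon between the two has the same limiting position.
  have hbetween : ∀ k, (i : ℕ) ≤ k → k ≤ j → ξ k T = Real.exp c := fun k h1 h2 =>
    le_antisymm (hCj ▸ hle k j h2 j.2) (hCi ▸ hle i k h1 (by omega))
  obtain ⟨o1, o2, o3, o4⟩ := hflow.orders_of_collision hT hm hlim (k := i) (by omega)
    (by rw [hCi, hbetween (i + 1) (by omega) (by omega)])
  have hji : (j : ℕ) = i + 1 := by
    by_contra hne
    exact o4 (by omega) (by
      rw [hbetween (i + 1) (by omega) (by omega), hbetween (i + 2) (by omega) (by omega)])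
  rw [← hji] at o2 o3
  have hmass : ∀ k : Fin (n + 1), (fun t => m t k) =ᶠ[𝓝[<] T] fun t => extendMass (m t) k :=
    fun k => Eventually.of_forall fun t => (extendMass_of_lt _ k.2).symm
  refine ⟨hji, o1.congr (hmass i), o2.congr (hmass j),
    fun t => Real.log (ξ j t) - Real.log (ξ i t),
    ((hξ j j.2).log (hξ0 j j.2)).sub ((hξ i i.2).log (hξ0 i i.2)), ?_, ?_⟩
  · filter_upwards [hmem, hξX i i.2, hξX j j.2] with t ht hti htj
    have h1 := h.strictMono hM (Ioo_subset_Ico_self ht) hij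
    rw [← hti, ← htj, expPosition_of_lt _ i.2, expPosition_of_lt _ j.2, Real.log_exp,
      Real.log_exp, abs_of_neg (sub_neg.2 h1), neg_sub]
  · have di := (hξ i i.2).differentiableAt
    have dj := (hξ j j.2).differentiableAt
    have o5 : HasLeftOrder (fun t => ξ j t - ξ i t) T 1 :=
      o3.congr ((hξX j j.2).symm.sub (hξX i i.2).symm)
    have h1 := o5.deriv_ne_zero (dj.sub di) (by rw [hCi, hCj, sub_self])
    rw [(dj.hasDerivAt.fun_sub di.hasDerivAt).deriv] at h1
    refine (((hξ j j.2).log (hξ0 j j.2)).sub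
      ((hξ i i.2).log (hξ0 i i.2))).analyticOrderAt_eq_one_of_zero_deriv_ne_zero
      (by simp [hCi, hCj]) ?_
    have h2 := (dj.hasDerivAt.log (hξ0 j j.2).ne').sub (di.hasDerivAt.log (hξ0 i i.2).ne')
    have h3 := h2.deriv
    rw [hCi, hCj, ← sub_div] at h3
    rw [h3]
    exact div_ne_zero h1 (Real.exp_pos c).ne'

end DPPeakon

theorem mainTheorem1 (n : ℕ) (x m : ℝ → Fin n → ℝ) (tc : ℝ) (htc : 0 < tc)
    (hsol : DPPeakon.IsPeakonSolution x m tc)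
    (hM : DPPeakon.constantOfMotion n (x 0) (m 0) ≠ 0) :
    (∀ i j : Fin n, DPPeakon.CollideAt x tc i j →
      DPPeakon.BlowsUpAt (fun t => m t i) tc) ∧
    (∀ i : Fin n, (∀ t ∈ Ico 0 tc, 0 < m t i) ∨ (∀ t ∈ Ico 0 tc, m t i < 0)) ∧
    ¬ DPPeakon.MultipleCollisionAt x tc ∧
    (∀ i j : Fin n, DPPeakon.CollideAt x tc i j →
      DPPeakon.HasSimpleZeroAt (fun t => |x t i - x t j|) tc) := by
  rcases n with _ | n
  · exact ⟨fun i => i.elim0, fun i => i.elim0, fun ⟨i, _⟩ => i.elim0, fun i => i.elim0⟩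
  refine ⟨?_, fun i => ?_, ?_, ?_⟩
  · rintro i j ⟨hne, c, hi, hj⟩
    rcases hne.lt_or_gt with hij | hij
    · exact (hsol.collision htc hM hij hi hj).2.1.tendsto_abs_atTop
    · exact (hsol.collision htc hM hij hj hi).2.2.1.tendsto_abs_atTop
  · have h0 : (0 : ℝ) ∈ Ico 0 tc := ⟨le_rfl, htc⟩
    rcases (hsol.mass_ne_zero hM h0 i).lt_or_gt with hneg | hpos
    · refine Or.inr fun t ht => ?_
      by_contra hcon
      obtain ⟨s, hs, hs0⟩ := isPreconnected_Ico.intermediate_value h0 ht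
        (hsol.continuousOn_mass i) ⟨hneg.le, not_lt.1 hcon⟩
      exact hsol.mass_ne_zero hM hs i hs0
    · refine Or.inl fun t ht => ?_
      by_contra hcon
      obtain ⟨s, hs, hs0⟩ := isPreconnected_Ico.intermediate_value ht h0
        (hsol.continuousOn_mass i) ⟨not_lt.1 hcon, hpos.le⟩
      exact hsol.mass_ne_zero hM hs i hs0
  · rintro ⟨i, j, k, hij, hik, hjk, c, hi, hj, hk⟩
    -- Any two of the three labels differ by one.
    have key : ∀ a b : Fin (n + 1), a ≠ b → Tendsto (fun t => x t a) (𝓝[<] tc) (𝓝 c) →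
        Tendsto (fun t => x t b) (𝓝[<] tc) (𝓝 c) → (b : ℕ) = a + 1 ∨ (a : ℕ) = b + 1 := by
      intro a b hab ha hb
      rcases hab.lt_or_gt with h | h
      · exact Or.inl (hsol.collision htc hM h ha hb).1
      · exact Or.inr (hsol.collision htc hM h hb ha).1
    have h1 := key i j hij hi hj
    have h2 := key i k hik hi hk
    have h3 := key j k hjk hj hk
    omega
  · rintro i j ⟨hne, c, hi, hj⟩
    rcases hne.lt_or_gt with hij | hij
    · exact (hsol.collision htc hM hij hi hj).2.2.2
    · simpa only [abs_sub_comm] using (hsol.collision htc hM hij hj hi).2.2.2
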